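/- Let $G$ be a connected (finite-dimensional, smooth) Lie group with identity $e$. Let $\mathcal X$ be a linear vector field on $G$, i.e. a smooth vector field whose flow $(\varphi_t)_{t\in\mathbb R}$ is a one-parameter group of automorphisms of $G$, and let $Y_1,\dots,Y_m$ be right-invariant vector fields on $G$. Consider the linear control system $$\Sigma_L:\quad \frac{dg}{dt}=\mathcal X(g)+\sum_{j=1}^m u_j(t)\,Y_j(g),$$ where the controls $u=(u_1,\dots,u_m)\colon\mathbb R\to\mathbb R^m$ are piecewise constant, with finitely many switching times in each bounded interval. A solution for $u$ is a continuous curve in $G$ that satisfies the equation at every time that is not a switching time of $u$. Then the following hold. 1. For every control $u$ and every $g\in G$ there is exactly one solution $t\mapsto\phi_t(u,g)$, $t\in\mathbb R$, with $\phi_0(u,g)=g$. 2. For every control $u$ (in particular for every constant $u\in\mathbb R^m$), every $g\in G$ and every $t\in\mathbb R$, $$\phi_t(u,g)=\phi_t(u,e)\,\varphi_t(g).$$ 3. (Cocycle property.) For every control $u$, every $g\in G$ and all $t,s\in\mathbb R$, $\ \phi_{t+s}(u,g)=\phi_s\big(u(t+\cdot),\phi_t(u,g)\big)$. 4. Consequently,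 if $t,s\in\mathbb R$ and $u$ has the constant value $c\in\mathbb R^m$ on the open interval between $t$ and $t+s$, then for every $g\in G$ $$\phi_{t+s}(u,g)=\phi_s(c,e)\,\varphi_s\big(\phi_t(u,g)\big).$$ In particular, if $t,s\ge 0$, $u=c_1$ on $[0,t]$ and $u=c_2$ on $(t,t+s]$ with constants $c_1,c_2\in\mathbb R^m$, then $$\phi_{t+s}(u,e)=\phi_s(c_2,e)\,\varphi_s\big(\phi_t(c_1,e)\big).$$ -/

import Mathlib

open scoped Manifold ContDiff Topology

namespace LinearControl

variable {E : Type*} [NormedAddCommGroup E] [NormedSpace ℝ E]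
  {H : Type*} [TopologicalSpace H] (I : ModelWithCorners ℝ E H)
  {G : Type*} [TopologicalSpace G] [ChartedSpace H G]

/-- `φ` is the (global) flow of the vector field `X`: for every `g` the curve `t ↦ φ t g` is the
integral curve of `X` through `g` at time `0`. -/
def IsFlow (X : (g : G) → TangentSpace I g) (φ : ℝ → G → G) : Prop :=
  ∀ g : G, φ 0 g = g ∧ IsMIntegralCurve (I := I) (fun t : ℝ => φ t g) X

/-- `f` is an automorphism of the Lie group `G`: a group automorphism that is smooth together with
its inverse. -/
def IsLieAutomorphism [Group G] (f : G → G) : Prop :=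
  ∃ e : G ≃* G, (∀ g, e g = f g) ∧ ContMDiff I I ∞ e ∧ ContMDiff I I ∞ e.symm

/-- A linear vector field on `G`: a smooth vector field that has a global flow consisting of
automorphisms of `G`. (The law `φ (s + t) = φ s ∘ φ t` holds for every flow of a smooth field.) -/
def IsLinearVectorField [Group G] [IsManifold I 1 G] (X : (g : G) → TangentSpace I g) : Prop :=
  ContMDiff I I.tangent ∞ (fun g : G => (⟨g, X g⟩ : TangentBundle I G)) ∧
    ∃ φ : ℝ → G → G, IsFlow I X φ ∧ ∀ t : ℝ, IsLieAutomorphism I (φ t)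

/-- `Y` is a right-invariant vector field: `Y (g h) = d(R_h)_g (Y g)`, where `R_h x = x h`. -/
def IsRightInvariant [Group G] (Y : (g : G) → TangentSpace I g) : Prop :=
  ∀ g h : G, Y (g * h) = mfderiv I I (fun x : G => x * h) g (Y g)

/-- The right-hand side `X g + ∑ j, v j • Y j g` of the control system at the control value `v`. -/
noncomputable def systemField {m : ℕ} (X : (g : G) → TangentSpace I g)
    (Y : Fin m → (g : G) → TangentSpace I g) (v : Fin m → ℝ) (g : G) : TangentSpace I g :=
  X g + ∑ j, v j • Y j g

/-- The switching times of a control: the times around which it is not locally constant. -/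
def switchTimes {m : ℕ} (u : ℝ → Fin m → ℝ) : Set ℝ :=
  {t | ¬ ∀ᶠ r in 𝓝 t, u r = u t}

/-- A control on `ℝ` is piecewise constant if each bounded interval contains only finitely many
switching times. -/
def IsPiecewiseConstant {m : ℕ} (u : ℝ → Fin m → ℝ) : Prop :=
  ∀ a b : ℝ, (switchTimes u ∩ Set.Icc a b).Finite

/-- `γ` is a solution on `ℝ`, starting at `g`, of `γ' = X(γ) + ∑ j, u j • Y j (γ)` for a piecewise
constant control `u`: it is continuous and satisfies the equation at every time that is not a
switching time of `u`. -/
structure IsSolution {m : ℕ} (X : (g : G) → TangentSpace I g)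
    (Y : Fin m → (g : G) → TangentSpace I g) (u : ℝ → Fin m → ℝ) (g : G) (γ : ℝ → G) : Prop where
  continuous : Continuous γ
  initial : γ 0 = g
  hasMFDerivAt : ∀ t : ℝ, t ∉ switchTimes u →
    HasMFDerivAt 𝓘(ℝ, ℝ) I γ t
      ((1 : ℝ →L[ℝ] ℝ).smulRight (systemField I X Y (u t) (γ t)))

open Classical in
/-- The point `φ_t(u, g)` reached at time `t` by the solution with control `u` starting at `g`
(a junk value if there is no solution). -/
noncomputable def solution {m : ℕ} (X : (g : G) → TangentSpace I g)
    (Y : Fin m → (g : G) → TangentSpace I g) (t : ℝ) (u : ℝ → Fin m → ℝ) (g : G) : G :=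
  if h : ∃ γ : ℝ → G, IsSolution I X Y u g γ then h.choose t else g

end LinearControl

/-!
At a time where the control switches nothing is required of a solution but continuity, so on a
compact interval existence and uniqueness follow by cutting at the finitely many switching times:
between two of them a solution is a piece of an integral curve of one field `X + ∑ j, c j • Y j`,
and this piece extends over the end points because these fields are complete.

Differentiating `φ t (a * b) = φ t a * φ t b` at `t = 0` gives the Leibniz rule
`X (a * b) = d(R_b) (X a) + d(L_a) (X b)`. Together with the right invariance of the `Y j` it shows
that a solution multiplied on the right by a flow line `t ↦ φ t g` is a solution for the same
control. With uniqueness this is the factorization. It also gives completeness: multiplying a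
local integral curve through `1` by flow lines yields integral curves through all points that are
defined for the same time.
-/

namespace LinearControl

open Set Filter

section ProductRule

variable {𝕜 : Type*} [NontriviallyNormedField 𝕜]
  {E : Type*} [NormedAddCommGroup E] [NormedSpace 𝕜 E]
  {H : Type*} [TopologicalSpace H] {I : ModelWithCorners 𝕜 E H}
  {G : Type*} [TopologicalSpace G] [ChartedSpace H G] [Mul G] [ContMDiffMul I 1 G]
  {E' : Type*} [NormedAddCommGroup E'] [NormedSpace 𝕜 E']
  {H' : Type*} [TopologicalSpace H'] {J : ModelWithCorners 𝕜 E' H'}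
  {N : Type*} [TopologicalSpace N] [ChartedSpace H' N]

theorem hasMFDerivAt_mul {f g : N → G} {x : N} {f' : TangentSpace J x →L[𝕜] TangentSpace I (f x)}
    {g' : TangentSpace J x →L[𝕜] TangentSpace I (g x)}
    (hf : HasMFDerivAt J I f x f') (hg : HasMFDerivAt J I g x g') :
    HasMFDerivAt J I (fun y => f y * g y) x
      ((mfderiv I I (fun a : G => a * g x) (f x)).comp f' +
        (mfderiv I I (fun a : G => f x * a) (g x)).comp g') := by
  have hmul : MDifferentiableAt (I.prod I) I (fun p : G × G => p.1 * p.2) (f x, g x) :=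
    (contMDiff_mul I 1).mdifferentiableAt one_ne_zero
  refine (hmul.hasMFDerivAt.comp x (hf.prodMk hg)).congr_mfderiv ?_
  ext v
  exact mfderiv_prod_eq_add_apply hmul

end ProductRule

section Flow

variable {E : Type*} [NormedAddCommGroup E] [NormedSpace ℝ E]
  {H : Type*} [TopologicalSpace H] {I : ModelWithCorners ℝ E H}
  {G : Type*} [TopologicalSpace G] [ChartedSpace H G]

theorem comp_smulRight_add_comp_smulRight {F₁ F₂ F : Type*}
    [AddCommGroup F₁] [Module ℝ F₁] [TopologicalSpace F₁] [ContinuousSMul ℝ F₁]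
    [AddCommGroup F₂] [Module ℝ F₂] [TopologicalSpace F₂] [ContinuousSMul ℝ F₂]
    [AddCommGroup F] [Module ℝ F] [TopologicalSpace F] [ContinuousSMul ℝ F] [ContinuousAdd F]
    (A : F₁ →L[ℝ] F) (B : F₂ →L[ℝ] F) (v : F₁) (w : F₂) :
    A.comp ((1 : ℝ →L[ℝ] ℝ).smulRight v) + B.comp ((1 : ℝ →L[ℝ] ℝ).smulRight w) =
      (1 : ℝ →L[ℝ] ℝ).smulRight (A v + B w) := by
  ext
  simp

theorem hasMFDerivAt_mul_curve [Mul G] [ContMDiffMul I 1 G] {γ δ : ℝ → G} {t : ℝ}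
    {v : TangentSpace I (γ t)} {w : TangentSpace I (δ t)}
    (hγ : HasMFDerivAt 𝓘(ℝ, ℝ) I γ t ((1 : ℝ →L[ℝ] ℝ).smulRight v))
    (hδ : HasMFDerivAt 𝓘(ℝ, ℝ) I δ t ((1 : ℝ →L[ℝ] ℝ).smulRight w)) :
    HasMFDerivAt 𝓘(ℝ, ℝ) I (fun r => γ r * δ r) t ((1 : ℝ →L[ℝ] ℝ).smulRight
      (mfderiv I I (fun x : G => x * δ t) (γ t) v +
        mfderiv I I (fun x : G => γ t * x) (δ t) w)) :=
  (hasMFDerivAt_mul hγ hδ).congr_mfderiv (comp_smulRight_add_comp_smulRight _ _ _ _)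

theorem IsFlow.apply_mul [Mul G] [ContMDiffMul I 1 G] {X : (g : G) → TangentSpace I g}
    {φ : ℝ → G → G} (hφ : IsFlow I X φ) (hmul : ∀ t a b, φ t (a * b) = φ t a * φ t b) (a b : G) :
    X (a * b) = mfderiv I I (fun x : G => x * b) a (X a) +
      mfderiv I I (fun x : G => a * x) b (X b) := by
  have h₁ := (hφ (a * b)).2 0
  have h₂ := (hasMFDerivAt_mul_curve ((hφ a).2 0) ((hφ b).2 0)).congr_of_eventuallyEq
    (f₁ := fun t => φ t (a * b)) (Eventually.of_forall fun t => hmul t a b)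
  have h := hasMFDerivAt_unique h₁ h₂
  simp only [ContinuousLinearMap.smulRight_one_eq_toSpanSingleton] at h
  have h' := ContinuousLinearMap.toSpanSingleton_inj.1 h
  beta_reduce at h'
  rwa [(hφ (a * b)).1, (hφ a).1, (hφ b).1] at h'

end Flow

section SystemField

variable {E : Type*} [NormedAddCommGroup E] [NormedSpace ℝ E]
  {H : Type*} [TopologicalSpace H] {I : ModelWithCorners ℝ E H}
  {G : Type*} [TopologicalSpace G] [ChartedSpace H G] [Group G] {m : ℕ}
  {X : (g : G) → TangentSpace I g} {Y : Fin m → (g : G) → TangentSpace I g} {φ : ℝ → G → G}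

theorem systemField_mul [ContMDiffMul I 1 G] (hφ : IsFlow I X φ)
    (hmul : ∀ t a b, φ t (a * b) = φ t a * φ t b) (hY : ∀ j, IsRightInvariant I (Y j))
    (c : Fin m → ℝ) (a b : G) :
    systemField I X Y c (a * b) = mfderiv I I (fun x : G => x * b) a (systemField I X Y c a) +
      mfderiv I I (fun x : G => a * x) b (X b) := by
  simp only [systemField, hφ.apply_mul hmul, map_add, map_sum, map_smul, hY _ a b]
  exact add_right_comm _ _ _

theorem hasMFDerivAt_mul_flow [ContMDiffMul I 1 G] (hφ : IsFlow I X φ)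
    (hmul : ∀ t a b, φ t (a * b) = φ t a * φ t b) (hY : ∀ j, IsRightInvariant I (Y j))
    {c : Fin m → ℝ} {γ : ℝ → G} {t : ℝ}
    (hγ : HasMFDerivAt 𝓘(ℝ, ℝ) I γ t ((1 : ℝ →L[ℝ] ℝ).smulRight (systemField I X Y c (γ t))))
    (g : G) :
    HasMFDerivAt 𝓘(ℝ, ℝ) I (fun r => γ r * φ r g) t
      ((1 : ℝ →L[ℝ] ℝ).smulRight (systemField I X Y c (γ t * φ t g))) := by
  rw [systemField_mul hφ hmul hY]
  exact hasMFDerivAt_mul_curve hγ ((hφ g).2 t)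

theorem contMDiff_of_isRightInvariant [ContMDiffMul I 2 G] {Y : (g : G) → TangentSpace I g}
    (hY : IsRightInvariant I Y) :
    ContMDiff I I.tangent 1 (fun g : G => (⟨g, Y g⟩ : TangentBundle I G)) := by
  have hmul : ContMDiff (I.prod I) I 2 (fun p : G × G => p.1 * p.2) := contMDiff_mul I 2
  have hpair : ContMDiff I (I.prod I).tangent 1 fun g : G =>
      (equivTangentBundleProd I G I G).symm (⟨1, Y 1⟩, ⟨g, 0⟩) :=
    contMDiff_equivTangentBundleProd_symm.comp
      (contMDiff_const.prodMk (Bundle.contMDiff_zeroSection ℝ (TangentSpace I)))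
  refine ((hmul.contMDiff_tangentMap (m := 1) (by norm_num)).comp hpair).congr fun g => ?_
  have hYg : mfderiv (I.prod I) I (fun p : G × G => p.1 * p.2) (1, g) (Y 1, 0) = Y (1 * g) := by
    refine (mfderiv_prod_eq_add_apply (hmul.mdifferentiableAt two_ne_zero)).trans ?_
    rw [hY 1 g]
    exact add_eq_left.2 (map_zero _)
  calc (⟨g, Y g⟩ : TangentBundle I G) = ⟨1 * g, Y (1 * g)⟩ := by rw [one_mul]
    _ = _ := by rw [← hYg]; rfl

theorem contMDiff_systemField [ContMDiffMul I 2 G]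
    (hX : ContMDiff I I.tangent 1 (fun g : G => (⟨g, X g⟩ : TangentBundle I G)))
    (hY : ∀ j, IsRightInvariant I (Y j)) (c : Fin m → ℝ) :
    ContMDiff I I.tangent 1 (fun g : G => (⟨g, systemField I X Y c g⟩ : TangentBundle I G)) :=
  hX.add_section (ContMDiff.sum_section fun j _ =>
    (contMDiff_of_isRightInvariant (hY j)).const_smul_section)

end SystemField

section Control

variable {m : ℕ} {u : ℝ → Fin m → ℝ}

theorem exists_eq_on_Ioo_of_disjoint_switchTimes {a b : ℝ}
    (h : Disjoint (switchTimes u) (Ioo a b)) : ∃ c, ∀ t ∈ Ioo a b, u t = c := by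
  have hloc : IsLocallyConstant fun t : Ioo a b => u t :=
    (IsLocallyConstant.iff_eventually_eq _).2 fun t =>
      continuous_subtype_val.continuousAt.eventually (not_not.1 (h.notMem_of_mem_right t.2))
  have : PreconnectedSpace (Ioo a b) := isPreconnected_iff_preconnectedSpace.1 isPreconnected_Ioo
  obtain ⟨c, hc⟩ := hloc.exists_eq_const
  exact ⟨c, fun t ht => congrFun hc ⟨t, ht⟩⟩

theorem notMem_switchTimes_of_eq_on_Ioo {c : Fin m → ℝ} {a b t : ℝ}
    (h : ∀ r ∈ Ioo a b, u r = c) (ht : t ∈ Ioo a b) : t ∉ switchTimes u := by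
  refine not_not.2 ?_
  filter_upwards [Ioo_mem_nhds ht.1 ht.2] with r hr
  rw [h r hr, h t ht]

theorem IsPiecewiseConstant.interval_induction (hu : IsPiecewiseConstant u) {P : ℝ → ℝ → Prop}
    (const : ∀ a b c, (∀ t ∈ Ioo a b, u t = c) → P a b)
    (glue : ∀ a b c, a < b → b < c → b ∈ switchTimes u → P a b → P b c → P a c) (a b : ℝ) :
    P a b := by
  have hfin (a b : ℝ) : (switchTimes u ∩ Ioo a b).Finite :=
    (hu a b).subset (inter_subset_inter_right _ Ioo_subset_Icc_self)
  induction hn : (switchTimes u ∩ Ioo a b).ncard using Nat.strong_induction_on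
    generalizing a b with
  | _ n ih =>
    rcases (switchTimes u ∩ Ioo a b).eq_empty_or_nonempty with he | ⟨t, hsw, hat, htb⟩
    · obtain ⟨c, hc⟩ := exists_eq_on_Ioo_of_disjoint_switchTimes (disjoint_iff_inter_eq_empty.2 he)
      exact const a b c hc
    · have hlt {a' b' : ℝ} (hsub : Ioo a' b' ⊆ Ioo a b) (ht : t ∉ Ioo a' b') :
          (switchTimes u ∩ Ioo a' b').ncard < n :=
        hn ▸ ncard_lt_ncard ⟨inter_subset_inter_right _ hsub,
          fun h => ht (h ⟨hsw, hat, htb⟩).2⟩ (hfin a b)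
      exact glue a t b hat htb hsw
        (ih _ (hlt (Ioo_subset_Ioo_right htb.le) (fun h => lt_irrefl t h.2)) a t rfl)
        (ih _ (hlt (Ioo_subset_Ioo_left hat.le) (fun h => lt_irrefl t h.1)) t b rfl)

theorem switchTimes_const (c : Fin m → ℝ) : switchTimes (fun _ : ℝ => c) = ∅ := by
  simp [switchTimes]

theorem isPiecewiseConstant_const (c : Fin m → ℝ) : IsPiecewiseConstant (fun _ : ℝ => c) := by
  simp [IsPiecewiseConstant, switchTimes_const]

theorem mem_switchTimes_comp_add {t r : ℝ} :
    r ∈ switchTimes (fun s => u (t + s)) ↔ t + r ∈ switchTimes u := by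
  simp only [switchTimes, mem_ofPred_eq]
  rw [← map_add_left_nhds, eventually_map]

theorem IsPiecewiseConstant.comp_add (hu : IsPiecewiseConstant u) (t : ℝ) :
    IsPiecewiseConstant (fun s => u (t + s)) := by
  intro a b
  refine ((hu (t + a) (t + b)).preimage (add_right_injective t).injOn).subset ?_
  rintro r ⟨hr, har, hrb⟩
  exact ⟨mem_switchTimes_comp_add.1 hr, by linarith, by linarith⟩

end Control

section Switched

variable {E : Type*} [NormedAddCommGroup E] [NormedSpace ℝ E]
  {H : Type*} [TopologicalSpace H] {I : ModelWithCorners ℝ E H}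
  {M : Type*} [TopologicalSpace M] [ChartedSpace H M] {m : ℕ}

theorem hasMFDerivAt_congr_of_eventuallyEq {V : (x : M) → TangentSpace I x} {γ δ : ℝ → M} {t : ℝ}
    (h : HasMFDerivAt 𝓘(ℝ, ℝ) I γ t ((1 : ℝ →L[ℝ] ℝ).smulRight (V (γ t)))) (heq : δ =ᶠ[𝓝 t] γ) :
    HasMFDerivAt 𝓘(ℝ, ℝ) I δ t ((1 : ℝ →L[ℝ] ℝ).smulRight (V (δ t))) := by
  have hδ := h.congr_of_eventuallyEq heq
  rwa [← heq.eq_of_nhds] at hδ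

variable (I) in
/-- A complete `C^1` vector field: it has a global integral curve through every point. -/
structure IsCompleteField [IsManifold I 1 M] (V : (x : M) → TangentSpace I x) : Prop where
  contMDiff : ContMDiff I I.tangent 1 (fun x : M => (⟨x, V x⟩ : TangentBundle I M))
  exists_curve_zero (x : M) : ∃ ψ : ℝ → M, ψ 0 = x ∧ IsMIntegralCurve (I := I) ψ V

theorem IsCompleteField.exists_curve [IsManifold I 1 M] {V : (x : M) → TangentSpace I x}
    (hV : IsCompleteField I V) (t₀ : ℝ) (x : M) :
    ∃ ψ : ℝ → M, ψ t₀ = x ∧ IsMIntegralCurve (I := I) ψ V := by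
  obtain ⟨ψ, hψ₀, hψ⟩ := hV.exists_curve_zero x
  exact ⟨ψ ∘ (· + -t₀), by simp [hψ₀], hψ.comp_add _⟩

theorem IsCompleteField.eqOn_Icc [IsManifold I 1 M] [BoundarylessManifold I M] [T2Space M]
    {V : (x : M) → TangentSpace I x} (hV : IsCompleteField I V) {γ ψ : ℝ → M} {a b t₀ : ℝ}
    (hγ : Continuous γ) (hγV : ∀ t ∈ Ioo a b,
      HasMFDerivAt 𝓘(ℝ, ℝ) I γ t ((1 : ℝ →L[ℝ] ℝ).smulRight (V (γ t))))
    (hψ : IsMIntegralCurve (I := I) ψ V) (ht₀ : t₀ ∈ Icc a b) (h₀ : γ t₀ = ψ t₀) :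
    EqOn γ ψ (Icc a b) := by
  rcases (ht₀.1.trans ht₀.2).eq_or_lt with rfl | hab
  · rw [Icc_self, mem_singleton_iff] at ht₀
    simpa [ht₀] using h₀
  obtain ⟨t₁, ht₁⟩ := exists_between hab
  obtain ⟨χ, hχ₁, hχ⟩ := hV.exists_curve t₁ (γ t₁)
  have hIoo : EqOn γ χ (Ioo a b) :=
    isMIntegralCurveOn_Ioo_eqOn_of_contMDiff_boundaryless ht₁ hV.contMDiff
      (fun t ht => (hγV t ht).hasMFDerivWithinAt) (hχ.isMIntegralCurveOn _) hχ₁.symm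
  have hIcc : EqOn γ χ (Icc a b) := by
    rw [← closure_Ioo hab.ne]
    exact hIoo.closure hγ hχ.continuous
  have hχψ : χ = ψ := isMIntegralCurve_Ioo_eq_of_contMDiff_boundaryless hV.contMDiff hχ hψ
    ((hIcc ht₀).symm.trans h₀)
  exact hχψ ▸ hIcc

/-- A continuous curve `γ` that satisfies the switched equation `γ' = F (u t) (γ)` at the times
in `s` at which the control `u` does not switch. -/
structure IsSwitchedCurveOn (F : (Fin m → ℝ) → (x : M) → TangentSpace I x) (u : ℝ → Fin m → ℝ)
    (γ : ℝ → M) (s : Set ℝ) : Prop where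
  continuous : Continuous γ
  hasMFDerivAt : ∀ t ∈ s, t ∉ switchTimes u →
    HasMFDerivAt 𝓘(ℝ, ℝ) I γ t ((1 : ℝ →L[ℝ] ℝ).smulRight (F (u t) (γ t)))

variable {F : (Fin m → ℝ) → (x : M) → TangentSpace I x} {u : ℝ → Fin m → ℝ} {γ γ₁ γ₂ : ℝ → M}

theorem IsSwitchedCurveOn.mono {s s' : Set ℝ} (h : IsSwitchedCurveOn F u γ s) (hs : s' ⊆ s) :
    IsSwitchedCurveOn F u γ s' :=
  ⟨h.continuous, fun t ht => h.hasMFDerivAt t (hs ht)⟩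

theorem IsSwitchedCurveOn.hasMFDerivAt_of_eq {c : Fin m → ℝ} {a b t : ℝ}
    (h : IsSwitchedCurveOn F u γ (Ioo a b)) (hc : ∀ r ∈ Ioo a b, u r = c) (ht : t ∈ Ioo a b) :
    HasMFDerivAt 𝓘(ℝ, ℝ) I γ t ((1 : ℝ →L[ℝ] ℝ).smulRight (F c (γ t))) :=
  hc t ht ▸ h.hasMFDerivAt t ht (notMem_switchTimes_of_eq_on_Ioo hc ht)

theorem IsSwitchedCurveOn.glue {a b c : ℝ} (hb : b ∈ switchTimes u)
    (h₁ : IsSwitchedCurveOn F u γ₁ (Ioo a b)) (h₂ : IsSwitchedCurveOn F u γ₂ (Ioo b c))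
    (h₀ : γ₁ b = γ₂ b) :
    ∃ γ, IsSwitchedCurveOn F u γ (Ioo a c) ∧ EqOn γ γ₁ (Iic b) ∧ EqOn γ γ₂ (Ici b) := by
  have heq₁ : EqOn (fun t => if t ≤ b then γ₁ t else γ₂ t) γ₁ (Iic b) := fun t ht => if_pos ht
  have heq₂ : EqOn (fun t => if t ≤ b then γ₁ t else γ₂ t) γ₂ (Ici b) := by
    intro t ht
    rcases eq_or_lt_of_le (mem_Ici.1 ht) with rfl | hbt
    · simpa using h₀
    · exact if_neg hbt.not_ge
  refine ⟨_, ⟨h₁.continuous.if_le h₂.continuous continuous_id continuous_const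
    (by rintro t rfl; exact h₀), fun t ht hsw => ?_⟩, heq₁, heq₂⟩
  rcases lt_trichotomy t b with htb | rfl | hbt
  · exact hasMFDerivAt_congr_of_eventuallyEq (h₁.hasMFDerivAt t ⟨ht.1, htb⟩ hsw)
      (heq₁.eventuallyEq_of_mem (Iic_mem_nhds htb))
  · exact absurd hb hsw
  · exact hasMFDerivAt_congr_of_eventuallyEq (h₂.hasMFDerivAt t ⟨hbt, ht.2⟩ hsw)
      (heq₂.eventuallyEq_of_mem (Ici_mem_nhds hbt))

variable [IsManifold I 1 M]

theorem exists_isSwitchedCurveOn_Ioo (hF : ∀ c, IsCompleteField I (F c))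
    (hu : IsPiecewiseConstant u) (a b : ℝ) :
    ∀ t₀ ∈ Icc a b, ∀ x : M, ∃ γ, IsSwitchedCurveOn F u γ (Ioo a b) ∧ γ t₀ = x := by
  induction a, b using hu.interval_induction with
  | const a b c hc =>
    intro t₀ _ x
    obtain ⟨ψ, hψ₀, hψ⟩ := (hF c).exists_curve t₀ x
    exact ⟨ψ, ⟨hψ.continuous, fun t ht _ => hc t ht ▸ hψ t⟩, hψ₀⟩
  | glue a b c hab hbc hb ih₁ ih₂ =>
    intro t₀ ht₀ x
    rcases le_total t₀ b with ht | ht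
    · obtain ⟨γ₁, hγ₁, hx⟩ := ih₁ t₀ ⟨ht₀.1, ht⟩ x
      obtain ⟨γ₂, hγ₂, hb₂⟩ := ih₂ b (left_mem_Icc.2 hbc.le) (γ₁ b)
      obtain ⟨γ, hγ, heq, -⟩ := hγ₁.glue hb hγ₂ hb₂.symm
      exact ⟨γ, hγ, (heq ht).trans hx⟩
    · obtain ⟨γ₂, hγ₂, hx⟩ := ih₂ t₀ ⟨ht, ht₀.2⟩ x
      obtain ⟨γ₁, hγ₁, hb₁⟩ := ih₁ b (right_mem_Icc.2 hab.le) (γ₂ b)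
      obtain ⟨γ, hγ, -, heq⟩ := hγ₁.glue hb hγ₂ hb₁
      exact ⟨γ, hγ, (heq ht).trans hx⟩

variable [BoundarylessManifold I M] [T2Space M]

theorem IsSwitchedCurveOn.eqOn_Icc (hF : ∀ c, IsCompleteField I (F c))
    (hu : IsPiecewiseConstant u) {a b t₀ : ℝ} (h₁ : IsSwitchedCurveOn F u γ₁ (Ioo a b))
    (h₂ : IsSwitchedCurveOn F u γ₂ (Ioo a b)) (ht₀ : t₀ ∈ Icc a b) (h₀ : γ₁ t₀ = γ₂ t₀) :
    EqOn γ₁ γ₂ (Icc a b) := by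
  induction a, b using hu.interval_induction generalizing t₀ with
  | const a b c hc =>
    obtain ⟨ψ, hψ₀, hψ⟩ := (hF c).exists_curve t₀ (γ₁ t₀)
    have heq₁ := (hF c).eqOn_Icc h₁.continuous (fun t => h₁.hasMFDerivAt_of_eq hc) hψ ht₀ hψ₀.symm
    have heq₂ := (hF c).eqOn_Icc h₂.continuous (fun t => h₂.hasMFDerivAt_of_eq hc) hψ ht₀
      (h₀.symm.trans hψ₀.symm)
    exact heq₁.trans heq₂.symm
  | glue a b c hab hbc _ ih₁ ih₂ =>
    have hleft {t₁ : ℝ} := ih₁ (t₀ := t₁) (h₁.mono (Ioo_subset_Ioo_right hbc.le))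
      (h₂.mono (Ioo_subset_Ioo_right hbc.le))
    have hright {t₁ : ℝ} := ih₂ (t₀ := t₁) (h₁.mono (Ioo_subset_Ioo_left hab.le))
      (h₂.mono (Ioo_subset_Ioo_left hab.le))
    have hb : γ₁ b = γ₂ b := by
      rcases le_total t₀ b with ht | ht
      · exact hleft ⟨ht₀.1, ht⟩ h₀ (right_mem_Icc.2 hab.le)
      · exact hright ⟨ht, ht₀.2⟩ h₀ (left_mem_Icc.2 hbc.le)
    rw [← Icc_union_Icc_eq_Icc hab.le hbc.le]
    exact (hleft (right_mem_Icc.2 hab.le) hb).union (hright (left_mem_Icc.2 hbc.le) hb)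

theorem exists_isSwitchedCurveOn_univ (hF : ∀ c, IsCompleteField I (F c))
    (hu : IsPiecewiseConstant u) (x : M) : ∃ γ, IsSwitchedCurveOn F u γ univ ∧ γ 0 = x := by
  have hmem (a : ℝ) : a ∈ Ioo (-(|a| + 1)) (|a| + 1) := abs_lt.1 (lt_add_one _)
  have hzero (a : ℝ) : (0 : ℝ) ∈ Icc (-(|a| + 1)) (|a| + 1) :=
    ⟨by linarith [abs_nonneg a], by positivity⟩
  choose γ hγ hγ₀ using fun a : ℝ =>
    exists_isSwitchedCurveOn_Ioo hF hu (-(|a| + 1)) (|a| + 1) 0 (hzero a) x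
  have hmono {a b : ℝ} (hab : |a| ≤ |b|) : EqOn (γ a) (γ b) (Icc (-(|a| + 1)) (|a| + 1)) :=
    (hγ a).eqOn_Icc hF hu ((hγ b).mono (Ioo_subset_Ioo (by linarith) (by linarith))) (hzero a)
      ((hγ₀ a).trans (hγ₀ b).symm)
  have hcoh (a : ℝ) : EqOn (fun t => γ t t) (γ a) (Ioo (-(|a| + 1)) (|a| + 1)) := by
    intro t ht
    rcases le_total |t| |a| with hta | hat
    · exact hmono hta (Ioo_subset_Icc_self (hmem t))
    · exact (hmono hat (Ioo_subset_Icc_self ht)).symm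
  have hnear (a : ℝ) : (fun t => γ t t) =ᶠ[𝓝 a] γ a :=
    (hcoh a).eventuallyEq_of_mem (isOpen_Ioo.mem_nhds (hmem a))
  refine ⟨fun t => γ t t, ⟨?_, fun t _ hsw => ?_⟩, hγ₀ 0⟩
  · exact continuous_iff_continuousAt.2 fun a =>
      (hγ a).continuous.continuousAt.congr (hnear a).symm
  · exact hasMFDerivAt_congr_of_eventuallyEq ((hγ t).hasMFDerivAt t (hmem t) hsw) (hnear t)

end Switched

section System

variable {E : Type*} [NormedAddCommGroup E] [NormedSpace ℝ E]
  {H : Type*} [TopologicalSpace H] {I : ModelWithCorners ℝ E H}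
  {G : Type*} [TopologicalSpace G] [ChartedSpace H G] {m : ℕ}
  {X : (g : G) → TangentSpace I g} {Y : Fin m → (g : G) → TangentSpace I g} {φ : ℝ → G → G}
  {u : ℝ → Fin m → ℝ} {c : Fin m → ℝ}

theorem IsSolution.isSwitchedCurveOn {g : G} {γ : ℝ → G} (h : IsSolution I X Y u g γ)
    (s : Set ℝ) : IsSwitchedCurveOn (systemField I X Y) u γ s :=
  ⟨h.continuous, fun t _ => h.hasMFDerivAt t⟩

theorem IsSolution.isMIntegralCurve {g : G} {γ : ℝ → G}
    (h : IsSolution I X Y (fun _ => c) g γ) :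
    IsMIntegralCurve (I := I) γ (systemField I X Y c) :=
  fun t => h.hasMFDerivAt t (by simp [switchTimes_const])

theorem IsSolution.comp_add {g : G} {γ : ℝ → G} (h : IsSolution I X Y u g γ) (t : ℝ) :
    IsSolution I X Y (fun r => u (t + r)) (γ t) (fun r => γ (t + r)) where
  continuous := h.continuous.comp (continuous_const.add continuous_id)
  initial := by rw [add_zero]
  hasMFDerivAt r hr := by
    have hγ := h.hasMFDerivAt (t + r) (mt mem_switchTimes_comp_add.2 hr)
    have hshift : HasMFDerivAt 𝓘(ℝ, ℝ) 𝓘(ℝ, ℝ) (fun r : ℝ => t + r) r (.id ℝ ℝ) :=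
      ((hasFDerivAt_id r).const_add t).hasMFDerivAt
    exact (hγ.comp r hshift).congr_mfderiv (ContinuousLinearMap.comp_id _)

theorem add_mem_uIoo {r s : ℝ} (t : ℝ) (hr : r ∈ uIoo 0 s) : t + r ∈ uIoo t (t + s) := by
  rcases le_total 0 s with hs | hs
  · simpa [uIoo_of_le, hs] using hr
  · simpa [uIoo_of_ge, hs] using hr

section Manifold

variable [IsManifold I 1 G] [BoundarylessManifold I G] [T2Space G]

theorem isSolution_solution (hF : ∀ c, IsCompleteField I (systemField I X Y c))
    (hu : IsPiecewiseConstant u) (g : G) :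
    IsSolution I X Y u g (fun t => solution I X Y t u g) := by
  have hex : ∃ γ : ℝ → G, IsSolution I X Y u g γ := by
    obtain ⟨γ, hγ, hγ₀⟩ := exists_isSwitchedCurveOn_univ hF hu g
    exact ⟨γ, hγ.continuous, hγ₀, fun t => hγ.hasMFDerivAt t (mem_univ t)⟩
  simpa only [solution, dif_pos hex] using hex.choose_spec

theorem IsSolution.eq_solution (hF : ∀ c, IsCompleteField I (systemField I X Y c))
    (hu : IsPiecewiseConstant u) {g : G} {γ : ℝ → G} (h : IsSolution I X Y u g γ) (t : ℝ) :
    γ t = solution I X Y t u g := by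
  have h' := isSolution_solution hF hu g
  exact (h.isSwitchedCurveOn _).eqOn_Icc hF hu (h'.isSwitchedCurveOn _) left_mem_uIcc
    (h.initial.trans h'.initial.symm) right_mem_uIcc

theorem solution_eq_of_eq_const (hF : ∀ c, IsCompleteField I (systemField I X Y c))
    (hu : IsPiecewiseConstant u) {s : ℝ} (hc : ∀ r ∈ uIoo 0 s, u r = c) (g : G) :
    solution I X Y s u g = solution I X Y s (fun _ => c) g := by
  have h := isSolution_solution hF hu g
  have h' := isSolution_solution hF (isPiecewiseConstant_const c) g
  exact (hF c).eqOn_Icc h.continuous (fun t => (h.isSwitchedCurveOn _).hasMFDerivAt_of_eq hc)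
    h'.isMIntegralCurve left_mem_uIcc (h.initial.trans h'.initial.symm) right_mem_uIcc

theorem solution_add (hF : ∀ c, IsCompleteField I (systemField I X Y c))
    (hu : IsPiecewiseConstant u) (g : G) (t s : ℝ) :
    solution I X Y (t + s) u g =
      solution I X Y s (fun r => u (t + r)) (solution I X Y t u g) :=
  ((isSolution_solution hF hu g).comp_add t).eq_solution hF (hu.comp_add t) s

end Manifold

variable [Group G]

theorem IsSolution.mul_flow [ContMDiffMul I 1 G] (hφ : IsFlow I X φ)
    (hmul : ∀ t a b, φ t (a * b) = φ t a * φ t b) (hY : ∀ j, IsRightInvariant I (Y j))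
    {a : G} {γ : ℝ → G} (h : IsSolution I X Y u a γ) (g : G) :
    IsSolution I X Y u (a * g) (fun t => γ t * φ t g) where
  continuous :=
    have := continuousMul_of_contMDiffMul I 1 (G := G)
    h.continuous.mul (hφ g).2.continuous
  initial := by rw [h.initial, (hφ g).1]
  hasMFDerivAt t ht := hasMFDerivAt_mul_flow hφ hmul hY (h.hasMFDerivAt t ht) g

variable [BoundarylessManifold I G] [T2Space G]

theorem IsLinearVectorField.flow_mul [IsManifold I 1 G] (hX : IsLinearVectorField I X)
    (hφ : IsFlow I X φ) (t : ℝ) (a b : G) : φ t (a * b) = φ t a * φ t b := by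
  obtain ⟨hsmooth, ψ, hψ, hψaut⟩ := hX
  have hφψ (g : G) : φ t g = ψ t g :=
    congrFun (isMIntegralCurve_Ioo_eq_of_contMDiff_boundaryless (t₀ := 0)
      (hsmooth.of_le (by simp)) (hφ g).2 (hψ g).2 ((hφ g).1.trans (hψ g).1.symm)) t
  obtain ⟨e, he, -⟩ := hψaut t
  simp only [hφψ, ← he, map_mul]

theorem isCompleteField_systemField [ContMDiffMul I 2 G] [CompleteSpace E]
    (hX : ContMDiff I I.tangent 1 (fun g : G => (⟨g, X g⟩ : TangentBundle I G)))
    (hφ : IsFlow I X φ) (hmul : ∀ t a b, φ t (a * b) = φ t a * φ t b)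
    (hY : ∀ j, IsRightInvariant I (Y j)) (c : Fin m → ℝ) :
    IsCompleteField I (systemField I X Y c) where
  contMDiff := contMDiff_systemField hX hY c
  exists_curve_zero := by
    have hC1 := contMDiff_systemField hX hY c
    obtain ⟨γ, hγ₀, hγ⟩ := exists_isMIntegralCurveAt_of_contMDiffAt_boundaryless 0
      hC1.contMDiffAt (x₀ := (1 : G))
    obtain ⟨ε, hε, hγε⟩ := isMIntegralCurveAt_iff'.1 hγ
    rw [Real.ball_eq_Ioo, zero_sub, zero_add] at hγε
    refine exists_isMIntegralCurve_of_isMIntegralCurveOn hC1 hε fun g =>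
      ⟨fun t => γ t * φ t g, by simp [hγ₀, (hφ g).1], fun t ht => ?_⟩
    have hγt := (hγε t ht).hasMFDerivAt (Ioo_mem_nhds ht.1 ht.2)
    exact (hasMFDerivAt_mul_flow hφ hmul hY hγt g).hasMFDerivWithinAt

variable [ContMDiffMul I 1 G]

theorem solution_eq_mul_flow (hF : ∀ c, IsCompleteField I (systemField I X Y c))
    (hφ : IsFlow I X φ) (hmul : ∀ t a b, φ t (a * b) = φ t a * φ t b)
    (hY : ∀ j, IsRightInvariant I (Y j)) (hu : IsPiecewiseConstant u) (g : G) (t : ℝ) :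
    solution I X Y t u g = solution I X Y t u 1 * φ t g := by
  have h := (isSolution_solution hF hu 1).mul_flow hφ hmul hY g
  rw [one_mul] at h
  exact (h.eq_solution hF hu t).symm

theorem solution_add_of_eq_const (hF : ∀ c, IsCompleteField I (systemField I X Y c))
    (hφ : IsFlow I X φ) (hmul : ∀ t a b, φ t (a * b) = φ t a * φ t b)
    (hY : ∀ j, IsRightInvariant I (Y j)) (hu : IsPiecewiseConstant u) (g : G) {t s : ℝ}
    (hc : ∀ r ∈ uIoo t (t + s), u r = c) :
    solution I X Y (t + s) u g =
      solution I X Y s (fun _ => c) 1 * φ s (solution I X Y t u g) := by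
  rw [solution_add hF hu,
    solution_eq_of_eq_const hF (hu.comp_add t) fun r hr => hc _ (add_mem_uIoo t hr),
    solution_eq_mul_flow hF hφ hmul hY (isPiecewiseConstant_const c)]

theorem solution_add_of_eq_const_of_eq_const
    (hF : ∀ c, IsCompleteField I (systemField I X Y c)) (hφ : IsFlow I X φ)
    (hmul : ∀ t a b, φ t (a * b) = φ t a * φ t b) (hY : ∀ j, IsRightInvariant I (Y j))
    (hu : IsPiecewiseConstant u) {c₁ c₂ : Fin m → ℝ} (g : G) {t s : ℝ}
    (h₁ : ∀ r ∈ uIoo 0 t, u r = c₁) (h₂ : ∀ r ∈ uIoo t (t + s), u r = c₂) :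
    solution I X Y (t + s) u g =
      solution I X Y s (fun _ => c₂) 1 * φ s (solution I X Y t (fun _ => c₁) g) := by
  rw [solution_add_of_eq_const hF hφ hmul hY hu g h₂, solution_eq_of_eq_const hF hu h₁]

end System

end LinearControl

open Set LinearControl in
theorem corollary3p5_general
    {E : Type*} [NormedAddCommGroup E] [NormedSpace ℝ E] [CompleteSpace E]
    {H : Type*} [TopologicalSpace H] (I : ModelWithCorners ℝ E H)
    {G : Type*} [TopologicalSpace G] [ChartedSpace H G] [Group G] [LieGroup I 2 G]
    [BoundarylessManifold I G]
    {m : ℕ} (X : (g : G) → TangentSpace I g) (Y : Fin m → (g : G) → TangentSpace I g)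
    (hX : ContMDiff I I.tangent 1 (fun g : G => (⟨g, X g⟩ : TangentBundle I G)))
    (hY : ∀ j, IsRightInvariant I (Y j))
    (φ : ℝ → G → G) (hφ : IsFlow I X φ) (hmul : ∀ t a b, φ t (a * b) = φ t a * φ t b) :
    (∀ u : ℝ → Fin m → ℝ, IsPiecewiseConstant u → ∀ g : G,
      IsSolution I X Y u g (fun t => solution I X Y t u g) ∧
      ∀ γ : ℝ → G, IsSolution I X Y u g γ →
        ∀ t : ℝ, γ t = solution I X Y t u g) ∧
    (∀ u : ℝ → Fin m → ℝ, IsPiecewiseConstant u → ∀ (g : G) (t : ℝ),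
      solution I X Y t u g = solution I X Y t u 1 * φ t g) ∧
    (∀ u : ℝ → Fin m → ℝ, IsPiecewiseConstant u → ∀ (g : G) (t s : ℝ),
      solution I X Y (t + s) u g =
        solution I X Y s (fun r => u (t + r)) (solution I X Y t u g)) ∧
    (∀ u : ℝ → Fin m → ℝ, IsPiecewiseConstant u →
      ∀ (c : Fin m → ℝ) (g : G) (t s : ℝ), (∀ r ∈ uIoo t (t + s), u r = c) →
        solution I X Y (t + s) u g =
          solution I X Y s (fun _ => c) 1 *
            φ s (solution I X Y t u g)) ∧
    (∀ u : ℝ → Fin m → ℝ, IsPiecewiseConstant u →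
      ∀ (c₁ c₂ : Fin m → ℝ) (t s : ℝ), 0 ≤ t → 0 ≤ s →
        (∀ r ∈ Icc 0 t, u r = c₁) → (∀ r ∈ Ioc t (t + s), u r = c₂) →
          solution I X Y (t + s) u 1 =
            solution I X Y s (fun _ => c₂) 1 *
              φ s (solution I X Y t (fun _ => c₁) 1)) := by
  have : T1Space G := I.t1Space G
  have : IsTopologicalGroup G := topologicalGroup_of_lieGroup I 2
  have hF := isCompleteField_systemField hX hφ hmul hY
  refine ⟨fun u hu g => ⟨isSolution_solution hF hu g, fun γ hγ => hγ.eq_solution hF hu⟩,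
    fun u hu => solution_eq_mul_flow hF hφ hmul hY hu,
    fun u hu => solution_add hF hu,
    fun u hu c g t s hc => solution_add_of_eq_const hF hφ hmul hY hu g hc,
    fun u hu c₁ c₂ t s ht hs h₁ h₂ => ?_⟩
  rw [← uIcc_of_le ht] at h₁
  rw [← uIoc_of_le (le_add_of_nonneg_right hs)] at h₂
  exact solution_add_of_eq_const_of_eq_const hF hφ hmul hY hu 1
    (fun r hr => h₁ r (uIoo_subset_uIcc_self hr)) fun r hr => h₂ r (Ioo_subset_Ioc_self hr)

theorem corollary3p5
    {E : Type*} [NormedAddCommGroup E] [NormedSpace ℝ E] [FiniteDimensional ℝ E]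
    {H : Type*} [TopologicalSpace H] (I : ModelWithCorners ℝ E H)
    {G : Type*} [TopologicalSpace G] [ChartedSpace H G] [Group G] [LieGroup I ∞ G]
    [BoundarylessManifold I G] [T2Space G] [ConnectedSpace G]
    {m : ℕ} (X : (g : G) → TangentSpace I g) (Y : Fin m → (g : G) → TangentSpace I g)
    (hX : LinearControl.IsLinearVectorField I X)
    (hY : ∀ j, LinearControl.IsRightInvariant I (Y j))
    (φ : ℝ → G → G) (hφ : LinearControl.IsFlow I X φ) :
    -- for each control and each starting point there is exactly one solution, namely `φ_t(u, g)`
    (∀ u : ℝ → Fin m → ℝ, LinearControl.IsPiecewiseConstant u → ∀ g : G,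
      LinearControl.IsSolution I X Y u g (fun t => LinearControl.solution I X Y t u g) ∧
      ∀ γ : ℝ → G, LinearControl.IsSolution I X Y u g γ →
        ∀ t : ℝ, γ t = LinearControl.solution I X Y t u g) ∧
    -- the factorization `φ_t(u, g) = φ_t(u, e) φ_t(g)`
    (∀ u : ℝ → Fin m → ℝ, LinearControl.IsPiecewiseConstant u → ∀ (g : G) (t : ℝ),
      LinearControl.solution I X Y t u g = LinearControl.solution I X Y t u 1 * φ t g) ∧
    -- the cocycle property
    (∀ u : ℝ → Fin m → ℝ, LinearControl.IsPiecewiseConstant u → ∀ (g : G) (t s : ℝ),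
      LinearControl.solution I X Y (t + s) u g =
        LinearControl.solution I X Y s (fun r => u (t + r)) (LinearControl.solution I X Y t u g)) ∧
    -- crossing one interval on which the control has the constant value `c`
    (∀ u : ℝ → Fin m → ℝ, LinearControl.IsPiecewiseConstant u →
      ∀ (c : Fin m → ℝ) (g : G) (t s : ℝ), (∀ r ∈ Set.uIoo t (t + s), u r = c) →
        LinearControl.solution I X Y (t + s) u g =
          LinearControl.solution I X Y s (fun _ => c) 1 *
            φ s (LinearControl.solution I X Y t u g)) ∧
    -- a control with the value `c₁` on `[0, t]` and `c₂` on `(t, t + s]`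
    (∀ u : ℝ → Fin m → ℝ, LinearControl.IsPiecewiseConstant u →
      ∀ (c₁ c₂ : Fin m → ℝ) (t s : ℝ), 0 ≤ t → 0 ≤ s →
        (∀ r ∈ Set.Icc 0 t, u r = c₁) → (∀ r ∈ Set.Ioc t (t + s), u r = c₂) →
          LinearControl.solution I X Y (t + s) u 1 =
            LinearControl.solution I X Y s (fun _ => c₂) 1 *
              φ s (LinearControl.solution I X Y t (fun _ => c₁) 1)) := by
  have := FiniteDimensional.complete ℝ E
  exact corollary3p5_general I X Y (hX.1.of_le (by simp)) hY φ hφ (hX.flow_mul hφ)
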